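/- Write $C_n$ for the cyclic group of order $n$. Let $K=\mathbb{Q}(\sqrt{D})$ with $D=-1$ or $D=-3$. Then $n=3$ is the only odd prime power $n=p^t$ ($p$ prime, $t\ge 1$) for which $C_n\oplus C_n$ occurs as a subgroup of $E(L)$ for some elliptic curve $E/K$ and some quadratic extension $L/K$. That is: 1. If $E/K$ is an elliptic curve, $L/K$ is a quadratic extension, and $n$ is an odd prime power such that $E(L)$ has a subgroup isomorphic to $C_n\oplus C_n$, then $n=3$. 2. The value $n=3$ occurs for each of the two fields $K$: if $E$ is the base change to $K$ of the curve $y^2+y=x^3+x^2+9x+1$ over $\mathbb{Q}$, then $E$ is an elliptic curve, and for $L=\mathbb{Q}(\sqrt{-1},\sqrt{-3})$, which is a quadratic extension of $K$, the group $E(L)$ has a subgroup isomorphic to $C_3\oplus C_3$. -/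

import Mathlib

universe u v

/-- `K = ℚ(√D)`: the field `K` of characteristic zero is generated over `ℚ` by a square root
of the integer `D`. -/
def IsRatAdjoinSqrt (K : Type*) [Field K] [CharZero K] (D : ℤ) : Prop :=
  ∃ s : K, s ^ 2 = (D : K) ∧ IntermediateField.adjoin ℚ {s} = ⊤

open Classical in
/-- `C_n ⊕ C_n ⊆ E(L)`: for a Weierstrass curve `E` over `K` and a field extension `L` of `K`,
the group `E(L)` of `L`-rational points has a subgroup isomorphic to `C_n ⊕ C_n`, where
`C_n = ℤ/nℤ`. -/
def ContainsCnSquared {K : Type*} [Field K] (E : WeierstrassCurve K) (L : Type*) [Field L]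
    [Algebra K L] (n : ℕ) : Prop :=
  ∃ f : ZMod n × ZMod n →+ (E.baseChange L).toAffine.Point, Function.Injective f

/-- The curve `y² + y = x³ + x² + 9x + 1` over `ℚ`, that is `[0, 1, 1, 9, 1]`. -/
def fullThreeTorsionCurve : WeierstrassCurve ℚ where
  a₁ := 0
  a₂ := 1
  a₃ := 1
  a₄ := 9
  a₆ := 1

/-! ### Slopes of chords as a two-cocycle -/

namespace WeierstrassCurve.Affine

open Polynomial

variable {F : Type*} [Field F] [DecidableEq F] {W : Affine F}

/-! A copy of `C_n ⊕ C_n` in `E(F)`, with `n` odd and nonzero in `F`, forces a primitive `n`-th root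
of unity into `F` (`exists_isPrimitiveRoot`). This is the usual consequence of the Weil pairing,
obtained here from translation eigenvalues.

Let `φ` be the embedding of the second factor. Functions with at most simple poles along the image
of `φ` are the sums `k + ∑ a j * λ(R, φ j)` with `∑ a j = 0`, where `λ` is the slope of the chord.
The value `a 0` contributes nothing to the sum and only records the pole at infinity. The cocycle
identity `lineSlope_add` shows that translation by `φ 1` shifts the coefficients `a` and changes
`k`. For `m ≠ 0` the coset of `f (m, 0)` is a set of `n` points with zero sum, hence the zero set of
such a function. A nonzero function has at most `n` zeros, so this one is an eigenvector of
translation, with eigenvalue an `n`-th root of unity. The eigenvalues are different from `1` and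
distinct for distinct `m`, so with `1` they make up `n` roots of unity.

If `L` is quadratic over `ℚ(√D)`, its degree is at most `4`, so `φ(n) ≤ 4` (Euler's function) and
`n` is `3` or `5`. For `n = 5` the field `L` would be `ℚ(ζ₅)`, in which a square root of a rational
integer is fixed by complex conjugation, against `D < 0`. For `n = 3` two inflection points, defined
over any field containing `√-3`, generate the subgroup. -/

lemma sub_eq_slope_mul {x₁ x₂ y₁ y₂ : F} (h₁ : W.Equation x₁ y₁) (h₂ : W.Equation x₂ y₂)
    (hxy : ¬(x₁ = x₂ ∧ y₁ = W.negY x₂ y₂)) :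
    y₁ - y₂ = W.slope x₁ x₂ y₁ y₂ * (x₁ - x₂) := by
  by_cases hx : x₁ = x₂
  · have hy := Y_eq_of_Y_ne h₁ h₂ hx fun h => hxy ⟨hx, h⟩
    simp [hx, hy]
  · rw [slope_of_X_ne hx, div_mul_cancel₀ _ (sub_ne_zero.mpr hx)]

/-- The equation of a curve along the line of slope `ℓ` through `(x₂, y₂)`, divided by `X - x₂`. -/
lemma slope_relation {x₁ x₂ y₁ y₂ : F} (h₁ : W.Equation x₁ y₁) (h₂ : W.Equation x₂ y₂)
    (hxy : ¬(x₁ = x₂ ∧ y₁ = W.negY x₂ y₂)) :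
    (2 * y₂ + W.a₁ * x₂ + W.a₃) * W.slope x₁ x₂ y₁ y₂ +
      (x₁ - x₂) * (W.addX x₁ x₂ (W.slope x₁ x₂ y₁ y₂) - x₂) =
      3 * x₂ ^ 2 + 2 * W.a₂ * x₂ + W.a₄ - W.a₁ * y₂ := by
  by_cases hx : x₁ = x₂
  · have hne : y₁ ≠ W.negY x₂ y₂ := fun h => hxy ⟨hx, h⟩
    have hy := Y_eq_of_Y_ne h₁ h₂ hx hne
    rw [slope_of_Y_ne hx hne]
    subst hx hy
    have : y₁ - W.negY x₁ y₁ ≠ 0 := sub_ne_zero.mpr hne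
    have e : 2 * y₁ + W.a₁ * x₁ + W.a₃ = y₁ - W.negY x₁ y₁ := by rw [negY]; ring
    rw [e, mul_div_cancel₀ _ this]
    ring
  · have hu : x₁ - x₂ ≠ 0 := sub_ne_zero.mpr hx
    have hl := sub_eq_slope_mul h₁ h₂ hxy
    generalize W.slope x₁ x₂ y₁ y₂ = ℓ at hl ⊢
    clear hxy
    obtain rfl : y₁ = y₂ + ℓ * (x₁ - x₂) := by linear_combination hl
    rw [equation_iff] at h₁ h₂
    apply mul_left_cancel₀ hu
    rw [addX]
    linear_combination h₁ - h₂

namespace Point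

/-- The slope of the line through two points, and zero if one of them is the point at infinity. -/
def lineSlope : W.Point → W.Point → F
  | some x₁ y₁ _, some x₂ y₂ _ => W.slope x₁ x₂ y₁ y₂
  | _, _ => 0

@[simp]
lemma lineSlope_zero (R : W.Point) : lineSlope R 0 = 0 := by
  cases R <;> rfl

lemma lineSlope_some {x₁ x₂ y₁ y₂ : F} (h₁ : W.Nonsingular x₁ y₁) (h₂ : W.Nonsingular x₂ y₂) :
    lineSlope (some x₁ y₁ h₁) (some x₂ y₂ h₂) = W.slope x₁ x₂ y₁ y₂ :=
  rfl

lemma not_eq_negY_of_add_ne_zero {x₁ x₂ y₁ y₂ : F} {h₁ : W.Nonsingular x₁ y₁}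
    {h₂ : W.Nonsingular x₂ y₂} (h : some x₁ y₁ h₁ + some x₂ y₂ h₂ ≠ 0) :
    ¬(x₁ = x₂ ∧ y₁ = W.negY x₂ y₂) :=
  fun hxy => h (add_of_Y_eq hxy.1 hxy.2)

/-- The slope of the line through two points is a two-cocycle on pairs in general position. -/
lemma lineSlope_add {P Q R : W.Point} (hP : P ≠ 0) (hR : R ≠ 0) (hPQ : P + Q ≠ 0) (hQR : Q + R ≠ 0)
    (h₁ : P + Q ≠ R) (h₂ : P + Q ≠ -R) (h₃ : P ≠ Q + R) :
    lineSlope (P + Q) R + lineSlope P Q = lineSlope P (Q + R) + lineSlope Q R := by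
  have h₄ : P ≠ -(Q + R) := fun h => h₂ (by rw [h]; abel)
  rcases P with _ | ⟨xP, yP, nP⟩
  · exact (hP rfl).elim
  rcases R with _ | ⟨xR, yR, nR⟩
  · exact (hR rfl).elim
  rcases Q with _ | ⟨xQ, yQ, nQ⟩
  · change lineSlope (_ + 0) _ + lineSlope _ 0 = lineSlope _ (0 + _) + 0
    simp
  have cPQ := not_eq_negY_of_add_ne_zero hPQ
  have cRQ : ¬(xR = xQ ∧ yR = W.negY xQ yQ) :=
    not_eq_negY_of_add_ne_zero (h₁ := nR) (h₂ := nQ) (by rwa [add_comm])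
  have hl := sub_eq_slope_mul nP.1 nQ.1 cPQ
  have hm := sub_eq_slope_mul nR.1 nQ.1 cRQ
  have rl := slope_relation nP.1 nQ.1 cPQ
  have rm := slope_relation nR.1 nQ.1 cRQ
  have hcomm : (some xQ yQ nQ : W.Point) + some xR yR nR = some xR yR nR + some xQ yQ nQ :=
    add_comm _ _
  have hslope : W.slope xQ xR yQ yR = W.slope xR xQ yR yQ := by
    by_cases hx : xR = xQ
    · have := Y_eq_of_Y_ne nR.1 nQ.1 hx fun h => cRQ ⟨hx, h⟩
      rw [hx, this]
    · rw [slope_of_X_ne hx, slope_of_X_ne (Ne.symm hx), ← neg_sub yR, ← neg_sub xR, neg_div_neg_eq]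
  rw [hcomm] at h₃ h₄ ⊢
  rw [add_some cPQ] at h₁ h₂ ⊢
  rw [add_some cRQ] at h₃ h₄ ⊢
  have n₁ := (X_eq_iff (h₁ := nonsingular_add nP nQ cPQ) (h₂ := nR)).not.mpr (by tauto)
  have n₂ := (X_eq_iff (h₁ := nP) (h₂ := nonsingular_add nR nQ cRQ)).not.mpr (by tauto)
  simp only [lineSlope_some]
  rw [hslope, slope_of_X_ne n₁, slope_of_X_ne n₂]
  have n₁' := sub_ne_zero.mpr n₁
  have n₂' := sub_ne_zero.mpr n₂
  clear h₁ h₂ h₃ h₄ cPQ cRQ n₁ n₂ hslope hPQ hQR hcomm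
  generalize W.slope xP xQ yP yQ = ℓ at *
  generalize W.slope xR xQ yR yQ = m at *
  clear hP hR nP nR
  obtain rfl : yP = yQ + ℓ * (xP - xQ) := by linear_combination hl
  obtain rfl : yR = yQ + m * (xR - xQ) := by linear_combination hm
  rw [div_add' _ _ _ n₁', div_add' _ _ _ n₂', div_eq_div_iff n₁' n₂']
  simp only [addX, addY, negAddY, negY] at rl rm ⊢
  -- After the substitutions the curve enters only through `rl` and `rm`, whose right sides agree
  -- because they depend on `Q` alone.
  linear_combination (W.a₁ + ℓ + m) * (rm - rl)

/-- This replaces the cocycle identity when `Q + R = 0`. Negation carries the line through `P`, `Q`,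
`-(P + Q)` to the line through `P + Q` and `-Q`, and turns a slope `ℓ` into `-ℓ - a₁`. -/
lemma lineSlope_add_neg {P Q : W.Point} (hPQ : P + Q ≠ 0) (hQ : Q ≠ 0) (hP : P ≠ 0)
    (h : P + Q ≠ -Q) :
    lineSlope (P + Q) (-Q) + lineSlope P Q = -W.a₁ := by
  have h' : P + Q ≠ Q := by simpa using hP
  rcases P with _ | ⟨xP, yP, nP⟩
  · exact (hP rfl).elim
  rcases Q with _ | ⟨xQ, yQ, nQ⟩
  · exact (hQ rfl).elim
  have cPQ := not_eq_negY_of_add_ne_zero hPQ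
  have hl := sub_eq_slope_mul nP.1 nQ.1 cPQ
  rw [add_some cPQ] at h h' ⊢
  have n₁ := (X_eq_iff (h₁ := nonsingular_add nP nQ cPQ) (h₂ := nQ)).not.mpr (by tauto)
  rw [neg_some, lineSlope_some, lineSlope_some, slope_of_X_ne n₁]
  have n₁' := sub_ne_zero.mpr n₁
  rw [div_add' _ _ _ n₁', div_eq_iff n₁']
  simp only [addX, addY, negAddY, negY]
  linear_combination - hl

end Point

end WeierstrassCurve.Affine

/-! ### Zeros of regular functions and the class group -/

namespace WeierstrassCurve.Affine

open Polynomial Module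
open scoped Polynomial.Bivariate

variable {F : Type*} [Field F] {W : Affine F}

namespace Point

/-- The `X`-coordinate of a point, with value zero at infinity. -/
def xCoord : W.Point → F
  | zero => 0
  | some x _ _ => x

/-- The `Y`-coordinate of a point, with value zero at infinity. -/
def yCoord : W.Point → F
  | zero => 0
  | some _ y _ => y

lemma nonsingular_coord {R : W.Point} (hR : R ≠ 0) : W.Nonsingular R.xCoord R.yCoord := by
  rcases R with _ | ⟨x, y, h⟩
  · exact (hR rfl).elim
  · exact h

lemma some_coord {R : W.Point} (hR : R ≠ 0) :
    some R.xCoord R.yCoord (nonsingular_coord hR) = R := by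
  rcases R with _ | ⟨x, y, h⟩
  · exact (hR rfl).elim
  · rfl

lemma eq_of_coord_eq {R S : W.Point} (hR : R ≠ 0) (hS : S ≠ 0) (hx : R.xCoord = S.xCoord)
    (hy : R.yCoord = S.yCoord) : R = S := by
  rw [← some_coord hR, ← some_coord hS, some.injEq]
  exact ⟨hx, hy⟩

lemma xCoord_eq_iff {R S : W.Point} (hR : R ≠ 0) (hS : S ≠ 0) :
    R.xCoord = S.xCoord ↔ R = S ∨ R = -S := by
  rw [X_eq_iff (h₁ := nonsingular_coord hR) (h₂ := nonsingular_coord hS), some_coord hR,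
    some_coord hS]

lemma xCoord_neg (R : W.Point) : (-R).xCoord = R.xCoord := by
  cases R <;> rfl

lemma lineSlope_eq [DecidableEq F] {R S : W.Point} (hR : R ≠ 0) (hS : S ≠ 0)
    (hx : R.xCoord ≠ S.xCoord) :
    lineSlope R S = (R.yCoord - S.yCoord) / (R.xCoord - S.xCoord) := by
  rcases R with _ | ⟨x, y, h⟩
  · exact (hR rfl).elim
  rcases S with _ | ⟨x', y', h'⟩
  · exact (hS rfl).elim
  exact slope_of_X_ne hx

end Point

namespace CoordinateRing

/-- Evaluation of regular functions at an affine point. -/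
noncomputable def evalHom {x y : F} (h : W.Equation x y) : W.CoordinateRing →ₐ[F] F :=
  ((quotientXYIdealEquiv (y := C y) h : _ ≃ₐ[F] F) : _ →ₐ[F] F).comp
    (Ideal.Quotient.mkₐ F (XYIdeal W x (C y)))

lemma evalHom_eq_zero_iff {x y : F} (h : W.Equation x y) {f : W.CoordinateRing} :
    evalHom h f = 0 ↔ f ∈ XYIdeal W x (C y) := by
  rw [evalHom, AlgHom.comp_apply, ← Ideal.Quotient.eq_zero_iff_mem]
  exact (quotientXYIdealEquiv (y := C y) h).map_eq_zero_iff

lemma evalHom_mk_C_X {x y : F} (h : W.Equation x y) : evalHom h (mk W (C X)) = x := by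
  have : evalHom h (XClass W x) = 0 :=
    (evalHom_eq_zero_iff h).mpr (Ideal.subset_span (by simp))
  rw [XClass, C_sub, map_sub, map_sub, sub_eq_zero] at this
  rw [this]
  exact (evalHom h).commutes x

lemma evalHom_mk_Y {x y : F} (h : W.Equation x y) : evalHom h (mk W Y) = y := by
  have : evalHom h (YClass W (C y)) = 0 :=
    (evalHom_eq_zero_iff h).mpr (Ideal.subset_span (by simp))
  rw [YClass, map_sub, map_sub, sub_eq_zero] at this
  rw [this]
  exact (evalHom h).commutes y

lemma evalHom_mk_C {x y : F} (h : W.Equation x y) (p : F[X]) :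
    evalHom h (mk W (C p)) = p.eval x := by
  have : ((evalHom h).comp (IsScalarTower.toAlgHom F F[X] W.CoordinateRing)) = aeval x := by
    ext
    simpa using evalHom_mk_C_X h
  simpa [aeval_def] using DFunLike.congr_fun this p

lemma evalHom_smul_basis {x y : F} (h : W.Equation x y) (p q : F[X]) :
    evalHom h (p • (1 : W.CoordinateRing) + q • mk W Y) = p.eval x + q.eval x * y := by
  rw [smul, smul, mul_one, map_add, map_mul, evalHom_mk_C, evalHom_mk_C, evalHom_mk_Y]

lemma finite_quotient_span {f : W.CoordinateRing} (hf : f ≠ 0) :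
    Module.Finite F (W.CoordinateRing ⧸ Ideal.span {f}) := by
  have hI : Ideal.span {f} ≠ ⊥ := by simpa using hf
  exact Module.Finite.equiv
    ((Ideal.quotientEquivDirectSum F (CoordinateRing.basis W) hI).symm)

/-- A nonzero regular function has at most as many zeros as the degree of its norm. -/
lemma card_le_natDegree_norm {f : W.CoordinateRing} (hf : f ≠ 0) (s : Finset W.Point)
    (h0 : ∀ R ∈ s, R ≠ 0)
    (hs : ∀ R (hR : R ∈ s), evalHom (Point.nonsingular_coord (h0 R hR)).1 f = 0) :
    s.card ≤ (Algebra.norm F[X] f).natDegree := by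
  have := finite_quotient_span hf
  rw [← finrank_quotient_span_eq_natDegree_norm (CoordinateRing.basis W) hf]
  -- Distinct zeros of `f` give distinct algebra maps from the quotient by `f` to `F`, and the
  -- dimension of the quotient bounds the number of these.
  refine le_trans ?_ (card_algHom_le_finrank F (W.CoordinateRing ⧸ Ideal.span {f}) F)
  let e : s → ((W.CoordinateRing ⧸ Ideal.span {f}) →ₐ[F] F) := fun R =>
    Ideal.Quotient.liftₐ _ (evalHom (Point.nonsingular_coord (h0 R R.2)).1) fun a ha => by
      obtain ⟨b, rfl⟩ := Ideal.mem_span_singleton'.mp ha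
      rw [map_mul, hs R R.2, mul_zero]
  have he : Function.Injective e := fun R S hRS => by
    have key (g : W.CoordinateRing) : evalHom (Point.nonsingular_coord (h0 R R.2)).1 g =
        evalHom (Point.nonsingular_coord (h0 S S.2)).1 g := by
      exact DFunLike.congr_fun hRS (Ideal.Quotient.mk _ g)
    refine Subtype.ext (Point.eq_of_coord_eq (h0 R R.2) (h0 S S.2) ?_ ?_)
    · simpa only [evalHom_mk_C_X] using key (mk W (C X))
    · simpa only [evalHom_mk_Y] using key (mk W Y)
  have := Nat.card_le_card_of_injective e he
  rwa [Nat.card_eq_fintype_card, Fintype.card_coe] at this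

end CoordinateRing

namespace Point

open CoordinateRing hiding mk
open scoped nonZeroDivisors

/-- The ideal of an affine point, and the unit ideal for the point at infinity. -/
noncomputable def ideal : W.Point → Ideal W.CoordinateRing
  | zero => ⊤
  | some x y _ => XYIdeal W x (C y)

/-- The ideal of a point as an invertible fractional ideal. -/
noncomputable def unitIdeal :
    W.Point → (FractionalIdeal W.CoordinateRing⁰ W.FunctionField)ˣ
  | zero => 1
  | some _ _ h => XYIdeal' (W := W) h

lemma coe_unitIdeal (R : W.Point) :
    (unitIdeal R : FractionalIdeal W.CoordinateRing⁰ W.FunctionField) = R.ideal := by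
  rcases R with _ | ⟨x, y, h⟩
  · exact (FractionalIdeal.coeIdeal_top W.CoordinateRing⁰ :
      ((⊤ : Ideal W.CoordinateRing) : FractionalIdeal W.CoordinateRing⁰ W.FunctionField) = 1).symm
  · rfl

lemma toClass_eq [DecidableEq F] (R : W.Point) :
    toClass R = Additive.ofMul (ClassGroup.mk W.FunctionField (unitIdeal R)) := by
  rcases R with _ | ⟨x, y, h⟩
  · exact (congrArg Additive.ofMul (map_one (ClassGroup.mk W.FunctionField))).symm
  · rfl

lemma mem_ideal_iff {R : W.Point} (hR : R ≠ 0) {f : W.CoordinateRing} :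
    f ∈ R.ideal ↔ evalHom (nonsingular_coord hR).1 f = 0 := by
  rw [evalHom_eq_zero_iff]
  rcases R with _ | ⟨x, y, h⟩
  · exact (hR rfl).elim
  · rfl

lemma ideal_eq_ker {R : W.Point} (hR : R ≠ 0) :
    R.ideal = RingHom.ker (evalHom (nonsingular_coord hR).1).toRingHom := by
  ext f
  rw [mem_ideal_iff hR, RingHom.mem_ker]
  rfl

lemma isMaximal_ideal {R : W.Point} (hR : R ≠ 0) : R.ideal.IsMaximal := by
  rw [ideal_eq_ker hR]
  exact RingHom.ker_isMaximal_of_surjective _ fun c =>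
    ⟨algebraMap F _ c, (evalHom (nonsingular_coord hR).1).commutes c⟩

lemma ideal_injOn {R S : W.Point} (hR : R ≠ 0) (hS : S ≠ 0) (h : R.ideal = S.ideal) : R = S := by
  have key (f : W.CoordinateRing) : evalHom (nonsingular_coord hR).1 f = 0 ↔
      evalHom (nonsingular_coord hS).1 f = 0 := by
    rw [← mem_ideal_iff hR, ← mem_ideal_iff hS, h]
  refine eq_of_coord_eq hR hS ?_ ?_
  · have := (key (CoordinateRing.mk W (C (X - C R.xCoord)))).mp (by rw [evalHom_mk_C]; simp)
    rw [evalHom_mk_C] at this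
    simp only [eval_sub, eval_X, eval_C] at this
    exact (sub_eq_zero.mp this).symm
  · have h1 (T : W.Point) (hT : T ≠ 0) : evalHom (nonsingular_coord hT).1
        ((-C R.yCoord) • (1 : W.CoordinateRing) + (1 : F[X]) • CoordinateRing.mk W Y) =
        T.yCoord - R.yCoord := by
      rw [evalHom_smul_basis]
      simp only [eval_neg, eval_C, eval_one]
      ring
    have := (key _).mp ((h1 R hR).trans (sub_self _))
    rw [h1 S hS] at this
    exact (sub_eq_zero.mp this).symm

/-- A finite set of affine points with zero sum is the zero set of a regular function whose norm
has degree at most the number of points. -/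
lemma exists_function_of_sum_eq_zero [DecidableEq F] (s : Finset W.Point) (h0 : ∀ R ∈ s, R ≠ 0)
    (hs : ∑ R ∈ s, R = 0) :
    ∃ f : W.CoordinateRing, f ≠ 0 ∧ (Algebra.norm F[X] f).natDegree ≤ s.card ∧
      ∀ R (hR : R ∈ s), evalHom (nonsingular_coord (h0 R hR)).1 f = 0 := by
  -- The homomorphism `toClass` turns the zero sum into triviality of the class of the product of
  -- the point ideals, so this product has a generator `f`.
  have hc : ClassGroup.mk W.FunctionField (∏ R ∈ s, unitIdeal R) = 1 := by
    have := congrArg toClass hs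
    rw [map_sum, toClass_zero] at this
    simp only [toClass_eq] at this
    rw [map_prod]
    exact this
  have hcoe : ((∏ R ∈ s, unitIdeal R : (FractionalIdeal W.CoordinateRing⁰ W.FunctionField)ˣ) :
      FractionalIdeal W.CoordinateRing⁰ W.FunctionField) =
      ((∏ R ∈ s, R.ideal : Ideal W.CoordinateRing) :
        FractionalIdeal W.CoordinateRing⁰ W.FunctionField) := by
    rw [Units.coe_prod]
    exact (Finset.prod_congr rfl fun R _ => coe_unitIdeal R).trans
      (map_prod (FractionalIdeal.coeIdealHom W.CoordinateRing⁰ W.FunctionField) _ _).symm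
  obtain ⟨f, hf0, hf⟩ := (ClassGroup.mk_eq_one_of_coe_ideal hcoe).mp hc
  -- The point ideals are distinct and maximal, so their product is their intersection and
  -- divisibility by `f` means vanishing on `s`.
  have hinf : ∏ R ∈ s, R.ideal = ⨅ R ∈ s, R.ideal :=
    Ideal.prod_eq_iInf_of_pairwise_isCoprime fun R hR S hS hRS => by
      have := isMaximal_ideal (h0 R hR)
      have := isMaximal_ideal (h0 S hS)
      exact Ideal.isCoprime_of_isMaximal fun h => hRS (ideal_injOn (h0 R hR) (h0 S hS) h)
  have hmem (g : W.CoordinateRing) : g ∈ Ideal.span {f} ↔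
      ∀ R (hR : R ∈ s), evalHom (nonsingular_coord (h0 R hR)).1 g = 0 := by
    rw [← hf, hinf]
    simp only [Ideal.mem_iInf]
    exact forall₂_congr fun R hR => mem_ideal_iff (h0 R hR)
  refine ⟨f, hf0, ?_, (hmem f).mp (Ideal.mem_span_singleton_self f)⟩
  rw [← finrank_quotient_span_eq_natDegree_norm (CoordinateRing.basis W) hf0]
  -- The quotient by `f` embeds into `F^s` by evaluation, which bounds the degree of the norm.
  let e : W.CoordinateRing →ₗ[F] (s → F) :=
    LinearMap.pi fun R => (evalHom (nonsingular_coord (h0 R R.2)).1).toLinearMap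
  have hker : (Ideal.span {f}).restrictScalars F = LinearMap.ker e := by
    ext g
    rw [Submodule.restrictScalars_mem, hmem, LinearMap.mem_ker, funext_iff]
    simp [e]
  have h1 : finrank F (W.CoordinateRing ⧸ (Ideal.span {f}).restrictScalars F) ≤ s.card := by
    rw [hker, e.quotKerEquivRange.finrank_eq]
    refine (Submodule.finrank_le _).trans ?_
    simp
  exact h1

end Point

end WeierstrassCurve.Affine

/-! ### Functions with simple poles along a cyclic subgroup -/

namespace WeierstrassCurve.Affine

open Polynomial Module
open scoped Polynomial.Bivariate

namespace CoordinateRing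

variable {F : Type*} [Field F] {W : Affine F}

/-- The degree of the norm is the pole order at infinity, where `X` has order `2` and `Y` has order
`3`. The two parities prevent cancellation. -/
lemma natDegree_norm_smul_basis_le_iff {p q : F[X]} {N : ℕ} :
    (Algebra.norm F[X] (p • (1 : W.CoordinateRing) + q • mk W Y)).natDegree ≤ N ↔
      2 * p.natDegree ≤ N ∧ (q = 0 ∨ 2 * q.natDegree + 3 ≤ N) := by
  rw [natDegree_le_iff_degree_le, degree_norm_smul_basis, max_le_iff]
  refine and_congr ?_ ?_
  · by_cases hp : p = 0
    · simp [hp]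
    · rw [degree_eq_natDegree hp, nsmul_eq_mul]
      norm_cast
  · by_cases hq : q = 0
    · simp [hq]
    · rw [degree_eq_natDegree hq]
      simp only [hq, false_or, nsmul_eq_mul]
      norm_cast

end CoordinateRing

namespace Point

open CoordinateRing hiding mk

variable {F : Type*} [Field F] [DecidableEq F] {W : Affine F} {n : ℕ}

lemma map_ne_zero_of_injective {φ : ZMod n →+ W.Point} (hφ : Function.Injective φ) {j : ZMod n} (hj : j ≠ 0) : φ j ≠ 0 :=
  (map_ne_zero_iff φ hφ).mpr hj

lemma ne_zero_of_notMem_range {φ : ZMod n →+ W.Point} {R : W.Point} (hR : R ∉ Set.range φ) :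
    R ≠ 0 :=
  fun h => hR ⟨0, by rw [h, _root_.map_zero]⟩

lemma xCoord_map_eq_iff {φ : ZMod n →+ W.Point} (hφ : Function.Injective φ) {i j : ZMod n} (hi : i ≠ 0) (hj : j ≠ 0) :
    (φ i).xCoord = (φ j).xCoord ↔ i = j ∨ i = -j := by
  rw [xCoord_eq_iff (map_ne_zero_of_injective hφ hi) (map_ne_zero_of_injective hφ hj), ← map_neg,
    hφ.eq_iff, hφ.eq_iff]

lemma yCoord_neg_ne {φ : ZMod n →+ W.Point} (hn : Odd n) (hφ : Function.Injective φ) {i : ZMod n} (hi : i ≠ 0) :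
    (φ i).yCoord ≠ (φ (-i)).yCoord := fun h =>
  ZMod.ne_neg_self hn hi <| hφ <| eq_of_coord_eq (map_ne_zero_of_injective hφ hi)
    (map_ne_zero_of_injective hφ (neg_ne_zero.mpr hi)) (by rw [map_neg, xCoord_neg]) h

variable [NeZero n]

/-- The `X`-coordinates of the nonzero points of a cyclic group of points. -/
def xCoords (φ : ZMod n →+ W.Point) : Finset F :=
  (Finset.univ.erase 0).image fun j => (φ j).xCoord

/-- The monic polynomial whose roots are the `X`-coordinates of a cyclic group of points. -/
noncomputable def nodal (φ : ZMod n →+ W.Point) : F[X] :=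
  ∏ t ∈ xCoords φ, (X - C t)

/-- The polynomial `nodal φ` divided by `X - x`, where `x` is the `X`-coordinate of `φ j`. -/
noncomputable def nodalCofactor (φ : ZMod n →+ W.Point) (j : ZMod n) : F[X] :=
  ∏ t ∈ (xCoords φ).erase (φ j).xCoord, (X - C t)

/-- The function `k + ∑ a j * λ(R, φ j)` on points `R`, where `λ` is the slope. -/
def slopeSum (φ : ZMod n →+ W.Point) (k : F) (a : ZMod n → F) (R : W.Point) : F :=
  k + ∑ j, a j * lineSlope R (φ j)

/-- The part without `Y` of the numerator of `slopeSum`. -/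
noncomputable def numeratorOne (φ : ZMod n →+ W.Point) (k : F) (a : ZMod n → F) : F[X] :=
  C k * nodal φ - ∑ j ∈ Finset.univ.erase 0, C (a j * (φ j).yCoord) * nodalCofactor φ j

/-- The coefficient of `Y` in the numerator of `slopeSum`. -/
noncomputable def numeratorY (φ : ZMod n →+ W.Point) (a : ZMod n → F) : F[X] :=
  ∑ j ∈ Finset.univ.erase 0, C (a j) * nodalCofactor φ j

variable {φ : ZMod n →+ W.Point}

lemma xCoord_mem_xCoords {j : ZMod n} (hj : j ≠ 0) : (φ j).xCoord ∈ xCoords φ :=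
  Finset.mem_image_of_mem _ (Finset.mem_erase.mpr ⟨hj, Finset.mem_univ j⟩)

/-- For odd `n` the nonzero indices fall into pairs `{j, -j}`, and these are the fibres of the
`X`-coordinate. -/
lemma two_mul_card_xCoords (hn : Odd n) (hφ : Function.Injective φ) :
    2 * (xCoords φ).card + 1 = n := by
  have h1 : (Finset.univ.erase (0 : ZMod n)).card = n - 1 := by
    rw [Finset.card_erase_of_mem (Finset.mem_univ _), Finset.card_univ, ZMod.card]
  rw [Finset.card_eq_sum_card_image (fun j => (φ j).xCoord)] at h1
  rw [Finset.sum_const_nat (m := 2)] at h1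
  · have := NeZero.pos n
    rw [xCoords]
    omega
  · intro x hx
    obtain ⟨j, hj, rfl⟩ := Finset.mem_image.mp hx
    have hj : j ≠ 0 := (Finset.mem_erase.mp hj).1
    rw [Finset.card_eq_two]
    refine ⟨j, -j, ZMod.ne_neg_self hn hj, ?_⟩
    ext i
    simp only [Finset.mem_filter, Finset.mem_erase, Finset.mem_univ, and_true, Finset.mem_insert,
      Finset.mem_singleton]
    constructor
    · rintro ⟨hi, h⟩
      exact (xCoord_map_eq_iff hφ hi hj).mp h
    · intro h
      have hi : i ≠ 0 := by rcases h with rfl | rfl <;> simpa using hj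
      exact ⟨hi, (xCoord_map_eq_iff hφ hi hj).mpr h⟩

lemma nodal_eq {j : ZMod n} (hj : j ≠ 0) :
    nodal φ = (X - C (φ j).xCoord) * nodalCofactor φ j :=
  (Finset.mul_prod_erase _ _ (xCoord_mem_xCoords hj)).symm

lemma natDegree_nodal : (nodal φ).natDegree = (xCoords φ).card :=
  natDegree_finsetProd_X_sub_C_eq_card _ _

lemma natDegree_nodalCofactor {j : ZMod n} (hj : j ≠ 0) :
    (nodalCofactor φ j).natDegree = (xCoords φ).card - 1 := by
  rw [nodalCofactor, natDegree_finsetProd_X_sub_C_eq_card,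
    Finset.card_erase_of_mem (xCoord_mem_xCoords hj)]

lemma monic_nodalCofactor (j : ZMod n) : (nodalCofactor φ j).Monic :=
  monic_prod_X_sub_C _ _

lemma card_xCoords_pos {j : ZMod n} (hj : j ≠ 0) : 0 < (xCoords φ).card :=
  Finset.card_pos.mpr ⟨_, xCoord_mem_xCoords hj⟩

lemma degree_nodalCofactor_lt {j : ZMod n} (hj : j ≠ 0) :
    (nodalCofactor φ j).degree < (xCoords φ).card := by
  rw [degree_eq_natDegree (monic_nodalCofactor j).ne_zero, natDegree_nodalCofactor hj]
  exact_mod_cast Nat.sub_lt (card_xCoords_pos hj) one_pos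

lemma eval_nodal_ne_zero {R : W.Point} (hR : R ∉ Set.range φ) (hφ : Function.Injective φ) :
    (nodal φ).eval R.xCoord ≠ 0 := by
  have hR0 := ne_zero_of_notMem_range hR
  rw [nodal, eval_prod, Finset.prod_ne_zero_iff]
  intro t ht
  obtain ⟨j, hj, rfl⟩ := Finset.mem_image.mp ht
  have hj : j ≠ 0 := (Finset.mem_erase.mp hj).1
  rw [eval_sub, eval_X, eval_C, sub_ne_zero, Ne,
    xCoord_eq_iff hR0 (map_ne_zero_of_injective hφ hj), ← map_neg]
  rintro (rfl | rfl) <;> exact hR ⟨_, rfl⟩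

lemma eval_nodalCofactor_ne_zero (j : ZMod n) : (nodalCofactor φ j).eval (φ j).xCoord ≠ 0 := by
  rw [nodalCofactor, eval_prod, Finset.prod_ne_zero_iff]
  intro t ht
  rw [eval_sub, eval_X, eval_C, sub_ne_zero]
  exact (Finset.mem_erase.mp ht).1.symm

lemma eval_nodalCofactor_eq_zero {i j : ZMod n} (hi : i ≠ 0) (h : (φ i).xCoord ≠ (φ j).xCoord) :
    (nodalCofactor φ j).eval (φ i).xCoord = 0 := by
  rw [nodalCofactor, eval_prod]
  exact Finset.prod_eq_zero (Finset.mem_erase.mpr ⟨h, xCoord_mem_xCoords hi⟩) (by simp)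

lemma nodalCofactor_congr {i j : ZMod n} (h : (φ i).xCoord = (φ j).xCoord) :
    nodalCofactor φ i = nodalCofactor φ j := by
  rw [nodalCofactor, nodalCofactor, h]

/-- The numerator of `slopeSum` over the denominator `nodal φ`. -/
lemma eval_numerator {R : W.Point} (hR : R ∉ Set.range φ) (hφ : Function.Injective φ) (k : F)
    (a : ZMod n → F) :
    (numeratorOne φ k a).eval R.xCoord + (numeratorY φ a).eval R.xCoord * R.yCoord =
      (nodal φ).eval R.xCoord * slopeSum φ k a R := by
  have hR0 := ne_zero_of_notMem_range hR
  rw [slopeSum, ← Finset.add_sum_erase _ _ (Finset.mem_univ (0 : ZMod n)), _root_.map_zero, lineSlope_zero,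
    mul_zero, zero_add, numeratorOne, numeratorY, eval_sub, eval_mul, eval_C, eval_finsetSum,
    eval_finsetSum, mul_add, Finset.mul_sum, Finset.sum_mul, mul_comm k, sub_add, sub_eq_add_neg,
    ← Finset.sum_sub_distrib, ← Finset.sum_neg_distrib]
  congr 1
  refine Finset.sum_congr rfl fun j hj => ?_
  have hj : j ≠ 0 := (Finset.mem_erase.mp hj).1
  have hx : R.xCoord ≠ (φ j).xCoord := by
    rw [Ne, xCoord_eq_iff hR0 (map_ne_zero_of_injective hφ hj), ← map_neg]
    rintro (rfl | rfl) <;> exact hR ⟨_, rfl⟩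
  rw [lineSlope_eq hR0 (map_ne_zero_of_injective hφ hj) hx, nodal_eq hj]
  simp only [eval_mul, eval_sub, eval_X, eval_C]
  field_simp [sub_ne_zero.mpr hx]
  ring

lemma sum_eval_nodalCofactor (hn : Odd n) (hφ : Function.Injective φ) {i : ZMod n} (hi : i ≠ 0)
    (c : ZMod n → F) :
    (∑ j ∈ Finset.univ.erase 0, C (c j) * nodalCofactor φ j).eval (φ i).xCoord =
      (c i + c (-i)) * (nodalCofactor φ i).eval (φ i).xCoord := by
  have hi' : -i ≠ 0 := neg_ne_zero.mpr hi
  rw [eval_finsetSum, Finset.sum_eq_add i (-i) (ZMod.ne_neg_self hn hi)]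
  · rw [nodalCofactor_congr (i := -i) (j := i) (by rw [map_neg, xCoord_neg])]
    simp only [eval_mul, eval_C]
    ring
  · rintro j hj ⟨h1, h2⟩
    have hj : j ≠ 0 := (Finset.mem_erase.mp hj).1
    rw [eval_mul, eval_nodalCofactor_eq_zero hi, mul_zero]
    rw [Ne, eq_comm, xCoord_map_eq_iff hφ hj hi]
    tauto
  · simp [hi]
  · simp [hi]

/-- At the `X`-coordinate of `φ i` only the terms `i` and `-i` survive, so `a i + a (-i) = 0` and
the same combination weighted by `Y`-coordinates vanishes. The two `Y`-coordinates differ, which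
gives `a i = 0`. -/
lemma numerator_eq_zero (hn : Odd n) (hφ : Function.Injective φ) {k : F} {a : ZMod n → F}
    (h1 : numeratorOne φ k a = 0) (hY : numeratorY φ a = 0) :
    k = 0 ∧ ∀ j, j ≠ 0 → a j = 0 := by
  have ha (i : ZMod n) (hi : i ≠ 0) : a i = 0 := by
    have e1 := congrArg (eval (φ i).xCoord) h1
    have e2 := congrArg (eval (φ i).xCoord) hY
    have hne := eval_nodalCofactor_ne_zero (φ := φ) i
    rw [numeratorY, sum_eval_nodalCofactor hn hφ hi, eval_zero, mul_eq_zero, or_iff_left hne] at e2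
    rw [numeratorOne, eval_sub, sum_eval_nodalCofactor hn hφ hi, nodal_eq hi] at e1
    simp only [eval_mul, eval_sub, eval_X, eval_C, sub_self, zero_mul, mul_zero, zero_sub, eval_zero,
      neg_eq_zero, mul_eq_zero, or_iff_left hne] at e1
    have hy := sub_ne_zero.mpr (yCoord_neg_ne hn hφ hi)
    have : a i * ((φ i).yCoord - (φ (-i)).yCoord) = 0 := by
      linear_combination e1 - (φ (-i)).yCoord * e2
    exact (mul_eq_zero.mp this).resolve_right hy
  refine ⟨?_, ha⟩
  rw [numeratorOne, Finset.sum_eq_zero, sub_zero, mul_eq_zero, C_eq_zero] at h1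
  · exact h1.resolve_right (monic_prod_X_sub_C _ _).ne_zero
  · intro j hj
    rw [ha j (Finset.mem_erase.mp hj).1, zero_mul, C_0, zero_mul]

lemma sum_nodalCofactor_mem (c : ZMod n → F) :
    ∑ j ∈ Finset.univ.erase 0, C (c j) * nodalCofactor φ j ∈ degreeLT F (xCoords φ).card := by
  refine Submodule.sum_mem _ fun j hj => ?_
  rw [← smul_eq_C_mul]
  exact Submodule.smul_mem _ _
    (mem_degreeLT.mpr (degree_nodalCofactor_lt (Finset.mem_erase.mp hj).1))

lemma numeratorY_mem (a : ZMod n → F) : numeratorY φ a ∈ degreeLT F (xCoords φ).card :=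
  sum_nodalCofactor_mem a

lemma numeratorOne_mem (k : F) (a : ZMod n → F) :
    numeratorOne φ k a ∈ degreeLT F ((xCoords φ).card + 1) := by
  refine Submodule.sub_mem _ ?_ ?_
  · rw [← smul_eq_C_mul]
    refine Submodule.smul_mem _ _ (mem_degreeLT.mpr ?_)
    refine degree_le_natDegree.trans_lt ?_
    rw [natDegree_nodal]
    exact_mod_cast Nat.lt_succ_self _
  · exact degreeLT_mono (Nat.le_succ _) (sum_nodalCofactor_mem _)

lemma coeff_numeratorY (a : ZMod n → F) :
    (numeratorY φ a).coeff ((xCoords φ).card - 1) = ∑ j ∈ Finset.univ.erase 0, a j := by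
  rw [numeratorY, finsetSum_coeff]
  refine Finset.sum_congr rfl fun j hj => ?_
  rw [coeff_C_mul, ← natDegree_nodalCofactor (Finset.mem_erase.mp hj).1,
    (monic_nodalCofactor j).coeff_natDegree, mul_one]

/-- Every pair of polynomials of suitable degrees is the numerator of a `slopeSum`. -/
lemma exists_numerator_eq (hn : Odd n) (hφ : Function.Injective φ) {p q : F[X]}
    (hp : p ∈ degreeLT F ((xCoords φ).card + 1)) (hq : q ∈ degreeLT F (xCoords φ).card) :
    ∃ (k : F) (a : ZMod n → F), numeratorOne φ k a = p ∧ numeratorY φ a = q := by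
  -- The numerators do not involve `a 0`, so this slot carries the constant `k`. Both sides then
  -- have dimension `n`, and injectivity suffices.
  let e : (ZMod n → F) →ₗ[F] degreeLT F ((xCoords φ).card + 1) × degreeLT F (xCoords φ).card :=
    { toFun := fun b => (⟨_, numeratorOne_mem (b 0) b⟩, ⟨_, numeratorY_mem b⟩)
      map_add' := fun b c => by
        refine Prod.ext (Subtype.ext ?_) (Subtype.ext ?_)
        · simp only [numeratorOne, Pi.add_apply, add_mul, C_add, Finset.sum_add_distrib,
            Prod.mk_add_mk, Submodule.coe_add]
          ring
        · simp only [numeratorY, Pi.add_apply, add_mul, C_add, Finset.sum_add_distrib,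
            Prod.mk_add_mk, Submodule.coe_add]
      map_smul' := fun r b => by
        refine Prod.ext (Subtype.ext ?_) (Subtype.ext ?_)
        · simp only [numeratorOne, Pi.smul_apply, smul_eq_mul, C_mul, mul_assoc,
            RingHom.id_apply, Prod.smul_mk, SetLike.mk_smul_mk, smul_eq_C_mul, mul_sub,
            Finset.mul_sum]
        · simp only [numeratorY, Pi.smul_apply, smul_eq_mul, C_mul, mul_assoc,
            RingHom.id_apply, Prod.smul_mk, SetLike.mk_smul_mk, smul_eq_C_mul,
            Finset.mul_sum] }
  have hinj : Function.Injective e := by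
    rw [injective_iff_map_eq_zero]
    intro b hb
    obtain ⟨h1, h2⟩ := Prod.ext_iff.mp hb
    obtain ⟨h0, h⟩ := numerator_eq_zero hn hφ (congrArg Subtype.val h1) (congrArg Subtype.val h2)
    funext j
    by_cases hj : j = 0
    · rw [hj]
      exact h0
    · exact h j hj
  have e1 := (degreeLTEquiv F ((xCoords φ).card + 1)).symm
  have e2 := (degreeLTEquiv F (xCoords φ).card).symm
  have := Module.Finite.equiv e1
  have := Module.Finite.equiv e2
  have hdim : finrank F (ZMod n → F) =
      finrank F (degreeLT F ((xCoords φ).card + 1) × degreeLT F (xCoords φ).card) := by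
    rw [finrank_prod, ← e1.finrank_eq, ← e2.finrank_eq]
    have := two_mul_card_xCoords hn hφ
    simp only [finrank_fintype_fun_eq_card, ZMod.card, Fintype.card_fin]
    omega
  obtain ⟨b, hb⟩ :=
    (LinearMap.injective_iff_surjective_of_finrank_eq_finrank hdim).mp hinj (⟨p, hp⟩, ⟨q, hq⟩)
  exact ⟨b 0, b, congrArg (fun z => (z.1 : F[X])) hb, congrArg (fun z => (z.2 : F[X])) hb⟩

/-- A nonzero `slopeSum` has at most `n` zeros, and fewer than `n` zeros if it has no pole at
infinity. -/
lemma card_zeros_slopeSum (hn : Odd n) (hφ : Function.Injective φ) {k : F} {a : ZMod n → F}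
    (ha : ∑ j, a j = 0) (hne : ¬(k = 0 ∧ a = 0)) (s : Finset W.Point)
    (hs : ∀ R ∈ s, R ∉ Set.range φ ∧ slopeSum φ k a R = 0) :
    s.card ≤ n ∧ (a 0 = 0 → s.card < n) := by
  have hcard := two_mul_card_xCoords hn hφ
  have ha' : a 0 + ∑ j ∈ Finset.univ.erase 0, a j = 0 := by
    rwa [Finset.add_sum_erase _ _ (Finset.mem_univ _)]
  have hf : numeratorOne φ k a • (1 : W.CoordinateRing) +
      numeratorY φ a • CoordinateRing.mk W Y ≠ 0 := fun h => by
    obtain ⟨h1, h2⟩ := smul_basis_eq_zero h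
    obtain ⟨hk, hj⟩ := numerator_eq_zero hn hφ h1 h2
    refine hne ⟨hk, funext fun j => ?_⟩
    by_cases h0 : j = 0
    · rw [Finset.sum_eq_zero fun j hj' => hj j (Finset.mem_erase.mp hj').1, add_zero] at ha'
      rw [h0, ha', Pi.zero_apply]
    · exact hj j h0
  have h0 (R) (hR : R ∈ s) : R ≠ 0 := ne_zero_of_notMem_range (hs R hR).1
  have hle := card_le_natDegree_norm hf s h0 fun R hR => by
    rw [evalHom_smul_basis, eval_numerator (hs R hR).1 hφ, (hs R hR).2, mul_zero]
  have hp : (numeratorOne φ k a).natDegree ≤ (xCoords φ).card :=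
    Nat.lt_succ_iff.mp <| by
      by_cases h : numeratorOne φ k a = 0
      · simp [h]
      · exact (natDegree_lt_iff_degree_lt h).mpr (mem_degreeLT.mp (numeratorOne_mem k a))
  have hq : numeratorY φ a = 0 ∨ (numeratorY φ a).natDegree < (xCoords φ).card := by
    by_cases h : numeratorY φ a = 0
    · exact .inl h
    · exact .inr ((natDegree_lt_iff_degree_lt h).mpr (mem_degreeLT.mp (numeratorY_mem a)))
  refine ⟨hle.trans (natDegree_norm_smul_basis_le_iff.mpr ⟨by omega, ?_⟩), fun h00 => ?_⟩
  · exact hq.imp_right fun h => by omega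
  -- If `a 0 = 0`, the top coefficient of `numeratorY` is `∑ a j = 0`, so the pole order at infinity
  -- falls below `n`.
  · have hle2 : s.card ≤ n - 1 := by
      refine hle.trans (natDegree_norm_smul_basis_le_iff.mpr ⟨by omega, ?_⟩)
      by_cases h : numeratorY φ a = 0
      · exact .inl h
      · have h1 := hq.resolve_left h
        have h2 : (numeratorY φ a).natDegree ≠ (xCoords φ).card - 1 := fun h2 => by
          have := coeff_numeratorY (φ := φ) a
          rw [← h2, coeff_natDegree] at this
          rw [h00, zero_add] at ha'
          exact h (leadingCoeff_eq_zero.mp (this.trans ha'))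
        right
        omega
    have := NeZero.pos n
    omega

/-- A set of `n` affine points with zero sum is contained in the zero set of a `slopeSum`. -/
lemma exists_slopeSum_eq_zero (hn : Odd n) (hφ : Function.Injective φ) (s : Finset W.Point)
    (hcard : s.card = n) (hs : ∀ R ∈ s, R ∉ Set.range φ) (hsum : ∑ R ∈ s, R = 0) :
    ∃ (k : F) (a : ZMod n → F), ∑ j, a j = 0 ∧ ¬(k = 0 ∧ a = 0) ∧
      ∀ R ∈ s, slopeSum φ k a R = 0 := by
  have h0 (R) (hR : R ∈ s) : R ≠ 0 := ne_zero_of_notMem_range (hs R hR)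
  obtain ⟨f, hf0, hdeg, hf⟩ := exists_function_of_sum_eq_zero s h0 hsum
  obtain ⟨p, q, rfl⟩ := exists_smul_basis_eq f
  rw [hcard, natDegree_norm_smul_basis_le_iff] at hdeg
  have hc := two_mul_card_xCoords hn hφ
  have hp : p ∈ degreeLT F ((xCoords φ).card + 1) := by
    refine mem_degreeLT.mpr (degree_le_natDegree.trans_lt ?_)
    exact_mod_cast (by omega : p.natDegree < (xCoords φ).card + 1)
  have hq : q ∈ degreeLT F (xCoords φ).card := by
    rcases hdeg.2 with rfl | h
    · exact Submodule.zero_mem _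
    · refine mem_degreeLT.mpr (degree_le_natDegree.trans_lt ?_)
      exact_mod_cast (by omega : q.natDegree < (xCoords φ).card)
  obtain ⟨k, a, rfl, rfl⟩ := exists_numerator_eq hn hφ hp hq
  -- Changing `a 0` leaves both numerators alone, so it can be chosen to make the sum zero.
  set a' := Function.update a 0 (-∑ j ∈ Finset.univ.erase 0, a j) with ha'
  have haj (j : ZMod n) (hj : j ∈ Finset.univ.erase 0) : a' j = a j :=
    Function.update_of_ne (Finset.mem_erase.mp hj).1 _ _
  have h1 : numeratorOne φ k a' = numeratorOne φ k a := by
    rw [numeratorOne, numeratorOne]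
    congr 1
    exact Finset.sum_congr rfl fun j hj => by rw [haj j hj]
  have hY : numeratorY φ a' = numeratorY φ a := by
    rw [numeratorY, numeratorY]
    exact Finset.sum_congr rfl fun j hj => by rw [haj j hj]
  refine ⟨k, a', ?_, ?_, fun R hR => ?_⟩
  · rw [← Finset.add_sum_erase _ _ (Finset.mem_univ (0 : ZMod n)), Finset.sum_congr rfl haj, ha',
      Function.update_self, neg_add_cancel]
  · rintro ⟨rfl, h⟩
    refine hf0 ?_
    rw [← h1, ← hY, h]
    simp [numeratorOne, numeratorY]
  · have := hf R hR
    rw [evalHom_smul_basis, ← h1, ← hY, eval_numerator (hs R hR) hφ, mul_eq_zero] at this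
    exact this.resolve_left (eval_nodal_ne_zero (hs R hR) hφ)

end Point

end WeierstrassCurve.Affine

/-! ### Translation eigenvalues and roots of unity -/

namespace WeierstrassCurve.Affine.Point

lemma apply_neg_natCast {F : Type*} [Field F] {n : ℕ} {a : ZMod n → F} {c : F} (h : ∀ j, a (j - 1) = c * a j) (i : ℕ) :
    a (-(i : ZMod n)) = c ^ i * a 0 := by
  induction i with
  | zero => simp
  | succ i ih =>
    rw [Nat.cast_succ, neg_add, ← sub_eq_add_neg, h, ih, pow_succ']
    ring

lemma apply_eq_pow_mul {F : Type*} [Field F] {n : ℕ} [NeZero n] {a : ZMod n → F} {c : F} (h : ∀ j, a (j - 1) = c * a j) (j : ZMod n) :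
    a j = c ^ (-j).val * a 0 := by
  rw [← apply_neg_natCast h, ZMod.natCast_zmod_val, neg_neg]

variable {F : Type*} [Field F] [DecidableEq F] {W : Affine F} {n : ℕ}

/-- The constant by which `lineSlope (R + φ 1) (φ j)` differs from a difference of slopes at `R`. -/
def slopeShift (φ : ZMod n →+ W.Point) (j : ZMod n) : F :=
  if j = -1 then -W.a₁ else lineSlope (φ 1) (φ j)

/-- This is the cocycle identity for `R`, `φ 1`, `φ j`. At `j = -1` the last two points cancel, and
`lineSlope_add_neg` supplies the constant `-a₁`. -/
lemma lineSlope_add_one (hn : n ≠ 1) {φ : ZMod n →+ W.Point} (hφ : Function.Injective φ)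
    {R : W.Point} (hR : R ∉ Set.range φ) (j : ZMod n) :
    lineSlope (R + φ 1) (φ j) =
      lineSlope R (φ (j + 1)) - lineSlope R (φ 1) + slopeShift φ j := by
  have h10 : (1 : ZMod n) ≠ 0 := by
    have := (ZMod.nontrivial_iff (n := n)).mpr hn
    exact one_ne_zero
  have hR0 := ne_zero_of_notMem_range hR
  have hφ0 {i : ZMod n} (hi : i ≠ 0) : φ i ≠ 0 := map_ne_zero_of_injective hφ hi
  have hadd (i : ZMod n) : R + φ 1 ≠ φ i := fun h =>
    hR ⟨i - 1, by rw [map_sub, ← h, add_sub_cancel_right]⟩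
  have hadd0 : R + φ 1 ≠ 0 := by simpa using hadd 0
  have haddn (i : ZMod n) : R + φ 1 ≠ -φ i := by simpa using hadd (-i)
  rw [slopeShift]
  split_ifs with hj
  · have := lineSlope_add_neg hadd0 (hφ0 h10) hR0 (haddn 1)
    rw [hj, map_neg, neg_add_cancel, _root_.map_zero, lineSlope_zero]
    linear_combination this
  · by_cases h0 : j = 0
    · simp [h0]
    · have hj1 : 1 + j ≠ 0 := fun h => hj (eq_neg_of_add_eq_zero_right h)
      have := lineSlope_add hR0 (hφ0 h0) hadd0 (by rw [← map_add]; exact hφ0 hj1) (hadd j)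
        (haddn j) (fun h => hR ⟨1 + j, by rw [map_add, ← h]⟩)
      rw [add_comm j, map_add]
      linear_combination this

variable [NeZero n]

/-- The condition `∑ a j = 0` removes the common term `lineSlope R (φ 1)`, which leaves a shift of
the coefficients. -/
lemma slopeSum_add_one (hn : n ≠ 1) {φ : ZMod n →+ W.Point} (hφ : Function.Injective φ)
    {R : W.Point} (hR : R ∉ Set.range φ) (k : F) {a : ZMod n → F} (ha : ∑ j, a j = 0) :
    slopeSum φ k a (R + φ 1) =
      slopeSum φ (k + ∑ j, a j * slopeShift φ j) (fun j => a (j - 1)) R := by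
  have h : ∑ j, a (j - 1) * lineSlope R (φ j) = ∑ j, a j * lineSlope R (φ (j + 1)) :=
    (Equiv.sum_comp (Equiv.addRight (1 : ZMod n)) _).symm.trans (by simp)
  simp only [slopeSum, lineSlope_add_one hn hφ hR, mul_add, mul_sub, Finset.sum_add_distrib,
    Finset.sum_sub_distrib, ← Finset.sum_mul, ha, h]
  ring

lemma slopeSum_sub_mul (φ : ZMod n →+ W.Point) (k k' c : F) (a a' : ZMod n → F) (R : W.Point) :
    slopeSum φ (k' - c * k) (fun j => a' j - c * a j) R =
      slopeSum φ k' a' R - c * slopeSum φ k a R := by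
  simp only [slopeSum, sub_mul, Finset.sum_sub_distrib, mul_add, Finset.mul_sum, mul_assoc]
  ring

lemma sum_zmod_eq_zero (hn : Odd n) : ∑ j : ZMod n, j = 0 := by
  by_contra h
  refine ZMod.ne_neg_self hn h ?_
  rw [← Finset.sum_neg_distrib]
  exact (Equiv.sum_comp (Equiv.neg (ZMod n)) _).symm

variable (f : ZMod n × ZMod n →+ W.Point)

/-- A coset of the second factor of a subgroup isomorphic to `C_n ⊕ C_n`. -/
def coset (m : ZMod n) : Finset W.Point :=
  Finset.univ.image fun j => f (m, j)

variable {f}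

lemma mem_coset (m j : ZMod n) : f (m, j) ∈ coset f m :=
  Finset.mem_image_of_mem _ (Finset.mem_univ j)

lemma card_coset (hf : Function.Injective f) (m : ZMod n) : (coset f m).card = n := by
  rw [coset, Finset.card_image_of_injective _ fun i j h => (Prod.ext_iff.mp (hf h)).2,
    Finset.card_univ, ZMod.card]

lemma notMem_range_of_mem_coset (hf : Function.Injective f) {m : ZMod n} (hm : m ≠ 0)
    {R : W.Point} (hR : R ∈ coset f m) :
    R ∉ Set.range (f.comp (AddMonoidHom.inr (ZMod n) (ZMod n))) := by
  obtain ⟨j, -, rfl⟩ := Finset.mem_image.mp hR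
  rintro ⟨i, hi⟩
  exact hm (Prod.ext_iff.mp (hf hi)).1.symm

lemma sum_coset (hn : Odd n) (hf : Function.Injective f) (m : ZMod n) :
    ∑ R ∈ coset f m, R = 0 := by
  rw [coset, Finset.sum_image fun i _ j _ h => (Prod.ext_iff.mp (hf h)).2, ← map_sum]
  have : ∑ j : ZMod n, (m, j) = 0 := by
    refine Prod.ext ?_ ?_
    · simp [Prod.fst_sum]
    · simp [Prod.snd_sum, sum_zmod_eq_zero hn]
  rw [this, _root_.map_zero]

/-- `c` is the eigenvalue, with respect to translation by `φ 1`, of a nonzero `slopeSum` that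
vanishes on a set of points `s`. -/
def IsTranslationEigenvalue (φ : ZMod n →+ W.Point) (s : Finset W.Point) (c : F) : Prop :=
  ∃ (k : F) (a : ZMod n → F), ∑ j, a j = 0 ∧ a 0 ≠ 0 ∧ (∀ j, a (j - 1) = c * a j) ∧
    k + ∑ j, a j * slopeShift φ j = c * k ∧ ∀ R ∈ s, slopeSum φ k a R = 0

lemma exists_isTranslationEigenvalue (hn : Odd n) (hn1 : n ≠ 1) (hf : Function.Injective f)
    {m : ZMod n} (hm : m ≠ 0) :
    ∃ c, IsTranslationEigenvalue (f.comp (AddMonoidHom.inr _ _)) (coset f m) c := by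
  set φ := f.comp (AddMonoidHom.inr (ZMod n) (ZMod n)) with hφdef
  have hφ : Function.Injective φ := fun i j h => (Prod.ext_iff.mp (hf h)).2
  have hrange (R) (hR : R ∈ coset f m) := notMem_range_of_mem_coset hf hm hR
  obtain ⟨k, a, ha, hne, hval⟩ :=
    exists_slopeSum_eq_zero hn hφ _ (card_coset hf m) hrange (sum_coset hn hf m)
  have ha0 : a 0 ≠ 0 := fun h =>
    ((card_zeros_slopeSum hn hφ ha hne _ fun R hR => ⟨hrange R hR, hval R hR⟩).2 h).ne
      (card_coset hf m)
  have hsum' : ∑ j, a (j - 1) = 0 := ((Equiv.subRight (1 : ZMod n)).sum_comp a).trans ha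
  -- With this `c`, the translate minus `c` times the function has zero coefficient at `0`. It still
  -- vanishes at the `n` points of the coset, which is too many unless it is zero.
  set c := a (-1) / a 0 with hc
  have hsum : ∑ j, (a (j - 1) - c * a j) = 0 := by
    rw [Finset.sum_sub_distrib, ← Finset.mul_sum, ha, hsum', mul_zero, sub_zero]
  have key : k + ∑ j, a j * slopeShift φ j - c * k = 0 ∧ (fun j => a (j - 1) - c * a j) = 0 := by
    by_contra hne'
    refine ((card_zeros_slopeSum hn hφ hsum hne' (coset f m) fun R hR => ⟨hrange R hR, ?_⟩).2
      ?_).ne (card_coset hf m)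
    · rw [slopeSum_sub_mul, hval R hR, mul_zero, sub_zero,
        ← slopeSum_add_one hn1 hφ (hrange R hR) k ha]
      obtain ⟨j, -, rfl⟩ := Finset.mem_image.mp hR
      have : f (m, j) + φ 1 = f (m, j + 1) := by simp [hφdef, ← map_add]
      rw [this]
      exact hval _ (mem_coset m _)
    · rw [hc, zero_sub, div_mul_cancel₀ _ ha0, sub_self]
  exact ⟨c, k, a, ha, ha0, fun j => sub_eq_zero.mp (congrFun key.2 j), sub_eq_zero.mp key.1, hval⟩

lemma IsTranslationEigenvalue.pow_eq_one {φ : ZMod n →+ W.Point} {s : Finset W.Point} {c : F}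
    (h : IsTranslationEigenvalue φ s c) : c ^ n = 1 := by
  obtain ⟨k, a, -, ha0, hshift, -⟩ := h
  have := apply_neg_natCast hshift n
  rw [ZMod.natCast_self, _root_.neg_zero] at this
  exact mul_right_cancel₀ ha0 (by rw [one_mul, ← this])

/-- For eigenvalue `1` the coefficients are all equal, so their sum `n * a 0` could not vanish. -/
lemma IsTranslationEigenvalue.ne_one (hn0 : (n : F) ≠ 0) {φ : ZMod n →+ W.Point}
    {s : Finset W.Point} {c : F} (h : IsTranslationEigenvalue φ s c) : c ≠ 1 := by
  rintro rfl
  obtain ⟨k, a, ha, ha0, hshift, -⟩ := h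
  rw [Finset.sum_congr rfl fun j _ => (apply_eq_pow_mul hshift j).trans (by rw [one_pow, one_mul]),
    Finset.sum_const, Finset.card_univ, ZMod.card, nsmul_eq_mul] at ha
  exact mul_ne_zero hn0 ha0 ha

/-- The eigenvalue determines `a` up to a scalar, and then `k` as well because `c ≠ 1`. Two cosets
with the same eigenvalue would give one function with `2n` zeros. -/
lemma IsTranslationEigenvalue.coset_eq (hn : Odd n) (hn0 : (n : F) ≠ 0) (hf : Function.Injective f)
    {m m' : ZMod n} (hm : m ≠ 0) (hm' : m' ≠ 0) {c : F}
    (h : IsTranslationEigenvalue (f.comp (AddMonoidHom.inr _ _)) (coset f m) c)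
    (h' : IsTranslationEigenvalue (f.comp (AddMonoidHom.inr _ _)) (coset f m') c) : m = m' := by
  have hc := h.ne_one hn0
  set φ := f.comp (AddMonoidHom.inr (ZMod n) (ZMod n))
  have hφ : Function.Injective φ := fun i j h => (Prod.ext_iff.mp (hf h)).2
  obtain ⟨k, a, ha, ha0, hshift, hk, hval⟩ := h
  obtain ⟨k', a', ha', ha0', hshift', hk', hval'⟩ := h'
  set r := a' 0 / a 0 with hr
  have ha'a : a' = fun j => r * a j := funext fun j => by
    rw [apply_eq_pow_mul hshift', apply_eq_pow_mul hshift, hr]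
    field_simp
  have hk'k : k' = r * k := by
    have h1 : ∑ j, a' j * slopeShift φ j = r * ∑ j, a j * slopeShift φ j := by
      rw [ha'a, Finset.mul_sum]
      exact Finset.sum_congr rfl fun j _ => mul_assoc _ _ _
    refine mul_left_cancel₀ (sub_ne_zero.mpr hc) ?_
    linear_combination r * hk - hk' + h1
  have hval'' (R) (hR : R ∈ coset f m) : slopeSum φ k' a' R = 0 := by
    have := hval R hR
    rw [slopeSum] at this
    rw [slopeSum, hk'k, ha'a]
    simp only [mul_assoc]
    rw [← Finset.mul_sum, ← mul_add, this, mul_zero]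
  by_contra hmm
  have hdisj : Disjoint (coset f m) (coset f m') := by
    rw [Finset.disjoint_left]
    intro R hR hR'
    obtain ⟨i, -, rfl⟩ := Finset.mem_image.mp hR
    obtain ⟨j, -, hj⟩ := Finset.mem_image.mp hR'
    exact hmm (Prod.ext_iff.mp (hf hj)).1.symm
  have := (card_zeros_slopeSum hn hφ ha' (fun h => ha0' (congrFun h.2 0))
    (coset f m ∪ coset f m') fun R hR => by
      rcases Finset.mem_union.mp hR with hR | hR
      · exact ⟨notMem_range_of_mem_coset hf hm hR, hval'' R hR⟩
      · exact ⟨notMem_range_of_mem_coset hf hm' hR, hval' R hR⟩).1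
  rw [Finset.card_union_of_disjoint hdisj, card_coset hf, card_coset hf] at this
  have := NeZero.pos n
  omega

/-- If `E(F)` has a subgroup isomorphic to `C_n ⊕ C_n`, then `F` contains a primitive `n`-th root
of unity. -/
theorem exists_isPrimitiveRoot (hn : Odd n) (hn0 : (n : F) ≠ 0) (hf : Function.Injective f) :
    ∃ ζ : F, IsPrimitiveRoot ζ n := by
  by_cases hn1 : n = 1
  · subst hn1
    exact ⟨1, IsPrimitiveRoot.one⟩
  choose c hc using fun (m : ZMod n) (hm : m ≠ 0) => exists_isTranslationEigenvalue hn hn1 hf hm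
  -- The index `0`, whose coset consists of the poles, receives the eigenvalue `1` that no other
  -- index has.
  let d : ZMod n → F := fun m => if hm : m = 0 then 1 else c m hm
  have hd (m : ZMod n) : d m ^ n = 1 := by
    by_cases hm : m = 0
    · simp [d, hm]
    · simpa [d, hm] using (hc m hm).pow_eq_one
  have hinj : Function.Injective fun m => rootsOfUnity.mkOfPowEq (d m) (hd m) := by
    intro m m' h
    have h : d m = d m' := congrArg (fun z : rootsOfUnity n F => ((z : Fˣ) : F)) h
    by_cases hm : m = 0 <;> by_cases hm' : m' = 0
    · rw [hm, hm']
    · simp only [d, hm, hm', dite_true, dite_false] at h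
      exact ((hc m' hm').ne_one hn0 h.symm).elim
    · simp only [d, hm, hm', dite_true, dite_false] at h
      exact ((hc m hm).ne_one hn0 h).elim
    · simp only [d, hm, hm', dite_false] at h
      exact (hc m hm).coset_eq hn hn0 hf hm hm' (h ▸ hc m' hm')
  have hcard := Nat.card_le_card_of_injective _ hinj
  rw [Nat.card_zmod] at hcard
  obtain ⟨ζ, hζ⟩ := card_rootsOfUnity_eq_iff_exists_isPrimitiveRoot.mp
    (le_antisymm (card_rootsOfUnity F n) hcard)
  exact ⟨ζ, hζ⟩

end WeierstrassCurve.Affine.Point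

/-! ### Roots of unity and square roots in number fields of small degree -/

open Polynomial Module

lemma IsRatAdjoinSqrt.finrank_le {K : Type*} [Field K] [CharZero K] {D : ℤ}
    (hK : IsRatAdjoinSqrt K D) : FiniteDimensional ℚ K ∧ finrank ℚ K ≤ 2 := by
  obtain ⟨s, hs, htop⟩ := hK
  have hmonic : (X ^ 2 - C (D : ℚ)).Monic := monic_X_pow_sub_C _ two_ne_zero
  have hroot : aeval s (X ^ 2 - C (D : ℚ)) = 0 := by simp [hs]
  have hint : IsIntegral ℚ s := ⟨_, hmonic, by simpa [aeval_def] using hroot⟩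
  have hfin := IntermediateField.adjoin.finiteDimensional hint
  have hrank := IntermediateField.adjoin.finrank hint
  rw [htop] at hfin hrank
  have e := IntermediateField.topEquiv (F := ℚ) (E := K)
  refine ⟨Module.Finite.equiv e.toLinearEquiv, ?_⟩
  rw [← e.toLinearEquiv.finrank_eq, hrank]
  exact (natDegree_le_of_dvd (minpoly.dvd ℚ s hroot) hmonic.ne_zero).trans
    (natDegree_X_pow_sub_C).le

lemma eq_three_or_five_of_totient_le {n : ℕ} (hn : Odd n) (hpk : IsPrimePow n)
    (h : n.totient ≤ 4) : n = 3 ∨ n = 5 := by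
  obtain ⟨p, k, hp, hk, rfl⟩ := (isPrimePow_nat_iff n).mp hpk
  have hpo : Odd p := Nat.Odd.of_mul_left (n := p ^ (k - 1)) (by
    rwa [← pow_succ', Nat.sub_add_cancel hk])
  rw [Nat.totient_prime_pow hp hk] at h
  have h2 := hp.two_le
  have h3 : 3 ≤ p := by
    rcases hpo with ⟨r, hr⟩
    omega
  obtain ⟨j, rfl⟩ : ∃ j, k = j + 1 := ⟨k - 1, by omega⟩
  rw [Nat.add_sub_cancel] at h
  rcases j with _ | j
  · rw [pow_zero, one_mul] at h
    rcases hpo with ⟨r, hr⟩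
    rw [zero_add, pow_one]
    omega
  · exfalso
    have h1 : 3 ≤ p ^ (j + 1) := h3.trans (Nat.le_self_pow (by omega) p)
    have : 3 * 2 ≤ p ^ (j + 1) * (p - 1) := Nat.mul_le_mul h1 (by omega)
    omega

lemma IsPrimitiveRoot.totient_le_finrank {L : Type*} [Field L] [CharZero L] [FiniteDimensional ℚ L]
    {n : ℕ} [NeZero n] {ζ : L} (hζ : IsPrimitiveRoot ζ n) : n.totient ≤ finrank ℚ L := by
  rw [← natDegree_cyclotomic n ℚ, cyclotomic_eq_minpoly_rat hζ (NeZero.pos n)]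
  exact minpoly.natDegree_le ζ

/-- A square in a number field of degree four containing the fifth roots of unity is not a negative
integer. -/
lemma IsPrimitiveRoot.sq_ne_neg_of_finrank_le_four {L : Type*} [Field L] [CharZero L]
    [FiniteDimensional ℚ L] (hL : finrank ℚ L ≤ 4) {ζ : L} (hζ : IsPrimitiveRoot ζ 5) {s : L}
    {D : ℤ} (hD : D < 0) (hs : s ^ 2 = D) : False := by
  have hirr := cyclotomic.irreducible_rat (n := 5) (by norm_num)
  have hdeg : (minpoly ℚ ζ).natDegree = finrank ℚ L := by
    refine le_antisymm (minpoly.natDegree_le ζ) (hL.trans ?_)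
    rw [← cyclotomic_eq_minpoly_rat hζ (by norm_num), natDegree_cyclotomic]
    decide
  have hint : IsIntegral ℚ ζ := .of_finite ℚ ζ
  have htop := (Field.primitive_element_iff_minpoly_natDegree_eq ℚ ζ).mpr hdeg
  have hadj : Algebra.adjoin ℚ {ζ} = ⊤ := by
    rw [← IntermediateField.adjoin_simple_toSubalgebra_of_isAlgebraic hint.isAlgebraic, htop,
      IntermediateField.top_toSubalgebra]
  have hcyc : IsCyclotomicExtension {5} ℚ L := by
    rw [IsCyclotomicExtension.iff_singleton]
    refine ⟨⟨ζ, hζ⟩, fun x => ?_⟩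
    have hx : x ∈ Algebra.adjoin ℚ {ζ} := hadj ▸ Algebra.mem_top
    exact Algebra.adjoin_mono (by simpa using hζ.pow_eq_one) hx
  let z := IsCyclotomicExtension.zeta 5 ℚ L
  have hz : IsPrimitiveRoot z 5 := IsCyclotomicExtension.zeta_spec 5 ℚ L
  -- The square of `z ↦ z²` is `z ↦ z⁴ = z⁻¹`, which is complex conjugation under any embedding in
  -- `ℂ`. Since `σ s = ±s`, this square fixes `s`, so `s` is real.
  let σ : L ≃ₐ[ℚ] L := IsCyclotomicExtension.fromZetaAut (hz.pow_of_coprime 2 (by decide)) hirr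
  have hσ : σ z = z ^ 2 :=
    IsCyclotomicExtension.fromZetaAut_spec (hz.pow_of_coprime 2 (by decide)) hirr
  let f : L →ₐ[ℚ] ℂ := IsAlgClosed.lift
  have hconj : (f.comp (σ : L →ₐ[ℚ] L)).comp (σ : L →ₐ[ℚ] L) =
      ((Complex.conjAe.restrictScalars ℚ : ℂ ≃ₐ[ℚ] ℂ) : ℂ →ₐ[ℚ] ℂ).comp f := by
    refine (hz.powerBasis ℚ).algHom_ext ?_
    have h1 : f z ^ 5 = 1 := by rw [← map_pow, hz.pow_eq_one, map_one]
    have h2 : ‖f z‖ = 1 := Complex.norm_eq_one_of_pow_eq_one h1 (by norm_num)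
    have h3 : (starRingEnd ℂ) (f z) = f z ^ 4 := by
      rw [← Complex.inv_eq_conj h2]
      exact inv_eq_of_mul_eq_one_right (by rw [← h1]; ring)
    simp [hσ, h3]
    ring
  have hσs : σ (σ s) = s := by
    have h : σ s ^ 2 = s ^ 2 := by rw [← map_pow, hs, map_intCast]
    rcases sq_eq_sq_iff_eq_or_eq_neg.mp h with h | h
    · rw [h, h]
    · rw [h, map_neg, h, neg_neg]
  have hreal : (starRingEnd ℂ) (f s) = f s := by
    have := DFunLike.congr_fun hconj s
    simpa [hσs] using this.symm
  obtain ⟨r, hr⟩ := Complex.conj_eq_iff_real.mp hreal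
  have h1 : f s ^ 2 = D := by rw [← map_pow, hs, map_intCast]
  rw [hr] at h1
  have h2 : r ^ 2 = (D : ℝ) := by exact_mod_cast h1
  have h3 : (D : ℝ) < 0 := by exact_mod_cast hD
  nlinarith [sq_nonneg r]

/-- Write `t = a + b * s` and suppose `t² = D'`. Then `2 * a * b * s` is rational. If `a * b ≠ 0`,
then `s` is rational with negative square; if `b = 0`, then `a² = D' < 0`; if `a = 0`, then `D * D'
= (D * b)²`. -/
lemma IsRatAdjoinSqrt.not_isSquare_int {K : Type*} [Field K] [CharZero K] {D D' : ℤ}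
    (hK : IsRatAdjoinSqrt K D) (hD : D < 0) (hD' : D' < 0) (h : ¬ IsSquare (D * D')) (t : K) :
    t ^ 2 ≠ (D' : K) := by
  obtain ⟨s, hs, htop⟩ := hK
  have hint : IsIntegral ℚ s :=
    .of_pow two_pos (by rw [hs]; exact isIntegral_intCast D)
  have ht : t ∈ Algebra.adjoin ℚ {s} := by
    rw [← IntermediateField.adjoin_simple_toSubalgebra_of_isAlgebraic hint.isAlgebraic, htop,
      IntermediateField.top_toSubalgebra]
    exact Algebra.mem_top
  obtain ⟨a, b, rfl⟩ : ∃ a b : ℚ, t = a + b * s := by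
    induction ht using Algebra.adjoin_induction with
    | mem x hx => exact ⟨0, 1, by simpa using hx⟩
    | algebraMap q => exact ⟨q, 0, by simp⟩
    | add x y _ _ hx hy =>
      obtain ⟨a, b, rfl⟩ := hx
      obtain ⟨c, d, rfl⟩ := hy
      exact ⟨a + c, b + d, by push_cast; ring⟩
    | mul x y _ _ hx hy =>
      obtain ⟨a, b, rfl⟩ := hx
      obtain ⟨c, d, rfl⟩ := hy
      exact ⟨a * c + D * (b * d), a * d + b * c, by push_cast; linear_combination b * d * hs⟩
  intro hsq
  have hDq : (D : ℚ) < 0 := by exact_mod_cast hD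
  have hDq' : (D' : ℚ) < 0 := by exact_mod_cast hD'
  have hneg (q : ℚ) {m : ℤ} (hm : (m : ℚ) < 0) : (q : K) ^ 2 ≠ (m : K) := fun hq => by
    have : q ^ 2 = (m : ℚ) := by exact_mod_cast hq
    nlinarith [sq_nonneg q]
  have key : ((2 * a * b : ℚ) : K) * s = ((D' - a ^ 2 - D * b ^ 2 : ℚ) : K) := by
    push_cast
    linear_combination hsq - (b : K) ^ 2 * hs
  by_cases hab : 2 * a * b = 0
  · rcases (mul_eq_zero.mp hab).imp_left (fun h => by simpa using h) with rfl | rfl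
    · refine h ((Rat.isSquare_intCast_iff).mp ⟨D * b, ?_⟩)
      rw [Rat.cast_zero, zero_add, mul_pow, hs] at hsq
      have : b ^ 2 * D = (D' : ℚ) := by exact_mod_cast hsq
      push_cast
      linear_combination - (D : ℚ) * this
    · refine hneg a hDq' ?_
      simpa using hsq
  · refine hneg ((D' - a ^ 2 - D * b ^ 2) / (2 * a * b)) hDq ?_
    rw [← hs]
    congr 1
    rw [Rat.cast_div, ← key, mul_div_cancel_left₀]
    exact_mod_cast hab

/-! ### Full three-torsion on the explicit curve -/

lemma exists_injective_zmod_three {A : Type*} [AddCommGroup A] {P Q : A} (hP : P + P = -P)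
    (hQ : Q + Q = -Q) (hP0 : P ≠ 0) (hQ0 : Q ≠ 0) (h1 : P ≠ Q) (h2 : P ≠ -Q) :
    ∃ f : ZMod 3 × ZMod 3 →+ A, Function.Injective f := by
  have hom (R : A) (hR : R + R = -R) : ∃ u : ZMod 3 →+ A, u 1 = R := by
    refine ⟨ZMod.lift 3 ⟨zmultiplesHom A R, ?_⟩, ?_⟩
    · have : R + R + R = 0 := by rw [hR, neg_add_cancel]
      rw [zmultiplesHom_apply, ← this, Nat.cast_ofNat, ofNat_zsmul]
      abel
    · simpa using ZMod.lift_coe 3 ⟨zmultiplesHom A R, _⟩ (1 : ℤ)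
  obtain ⟨u, hu⟩ := hom P hP
  obtain ⟨v, hv⟩ := hom Q hQ
  refine ⟨u.coprod v, (injective_iff_map_eq_zero _).mpr ?_⟩
  have hz (a : ZMod 3) : a = 0 ∨ a = 1 ∨ a = -1 := by decide +revert
  rintro ⟨a, b⟩ hab
  rw [AddMonoidHom.coprod_apply] at hab
  rcases hz a with rfl | rfl | rfl <;> rcases hz b with rfl | rfl | rfl <;>
    simp only [map_zero, map_neg, hu, hv, zero_add, add_zero, neg_eq_zero] at hab
  · rfl
  · exact (hQ0 hab).elim
  · exact (hQ0 hab).elim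
  · exact (hP0 hab).elim
  · exact (h2 (eq_neg_of_add_eq_zero_left hab)).elim
  · exact (h1 (by rwa [← sub_eq_add_neg, sub_eq_zero] at hab)).elim
  · exact (hP0 hab).elim
  · exact (h1 (by rwa [neg_add_eq_zero] at hab)).elim
  · exact (h2 (by rw [← neg_add, neg_eq_zero] at hab; exact eq_neg_of_add_eq_zero_left hab)).elim

namespace WeierstrassCurve.Affine.Point

/-- An inflection point is a point of order three. -/
lemma add_self_eq_neg {F : Type*} [Field F] [DecidableEq F] {W : Affine F} {x y ℓ : F}
    (h : W.Nonsingular x y) (hy : y ≠ W.negY x y)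
    (hl : ℓ * (y - W.negY x y) = 3 * x ^ 2 + 2 * W.a₂ * x + W.a₄ - W.a₁ * y)
    (hx : W.addX x x ℓ = x) : some x y h + some x y h = -some x y h := by
  have hslope : W.slope x x y y = ℓ := by
    rw [slope_of_Y_ne rfl hy, div_eq_iff (sub_ne_zero.mpr hy), hl]
  rw [add_self_of_Y_ne' hy]
  congr 1
  rw [some.injEq, hslope, negAddY, hx]
  simp

end WeierstrassCurve.Affine.Point

open WeierstrassCurve.Affine in
lemma exists_three_torsion {F : Type*} [Field F] [CharZero F] [DecidableEq F]
    {W : WeierstrassCurve.Affine F} (h₁ : W.a₁ = 0) (h₂ : W.a₂ = 1) (h₃ : W.a₃ = 1) (h₄ : W.a₄ = 9)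
    (h₆ : W.a₆ = 1) {r : F} (hr : r ^ 2 = -3) :
    ∃ f : ZMod 3 × ZMod 3 →+ W.Point, Function.Injective f := by
  have hr0 : r ≠ 0 := by
    rintro rfl
    norm_num at hr
  have hP : W.Nonsingular 1 3 := by
    rw [nonsingular_iff, equation_iff, h₁, h₂, h₃, h₄, h₆]
    norm_num
  -- The numbers `1` and `-4/3` are the rational roots of the 3-division polynomial `3x⁴ + 4x³ +
  -- 54x² + 15x - 76`. At `-4/3` the quadratic for `y` has discriminant `-3 * (35/9)²`.
  have hQ : W.Nonsingular (-4 / 3) ((-1 + 35 * r / 9) / 2) := by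
    rw [nonsingular_iff, equation_iff, h₁, h₂, h₃, h₄, h₆]
    refine ⟨by linear_combination (35 / 18) ^ 2 * hr, .inr fun h => hr0 ?_⟩
    linear_combination 9 / 35 * h
  -- The inflectional tangents have slopes `2` and `-r`, and satisfy `ℓ² = 3x + 1`.
  refine exists_injective_zmod_three (P := .some 1 3 hP)
    (Q := .some (-4 / 3) ((-1 + 35 * r / 9) / 2) hQ) (Point.add_self_eq_neg (ℓ := 2) hP ?_ ?_ ?_)
    (Point.add_self_eq_neg (ℓ := -r) hQ ?_ ?_ ?_) (Point.some_ne_zero _) (Point.some_ne_zero _)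
    ?_ ?_
  · rw [negY, h₁, h₃]
    norm_num
  · rw [negY, h₁, h₂, h₃, h₄]
    norm_num
  · rw [addX, h₁, h₂]
    norm_num
  · rw [negY, h₁, h₃]
    refine fun h => hr0 ?_
    linear_combination 9 / 35 * h
  · rw [negY, h₁, h₂, h₃, h₄]
    linear_combination -35 / 9 * hr
  · rw [addX, h₁, h₂]
    linear_combination hr
  · rw [Ne, Point.some.injEq]
    rintro ⟨h, -⟩
    norm_num [eq_div_iff] at h
  · rw [Ne, Point.neg_some, Point.some.injEq]
    rintro ⟨h, -⟩
    norm_num [eq_div_iff] at h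

instance : fullThreeTorsionCurve.IsElliptic := by
  refine ⟨?_⟩
  rw [isUnit_iff_ne_zero]
  norm_num [WeierstrassCurve.Δ, WeierstrassCurve.b₂, WeierstrassCurve.b₄, WeierstrassCurve.b₆,
    WeierstrassCurve.b₈, fullThreeTorsionCurve]

/-! ### Conclusion over quadratic extensions -/

lemma eq_three_of_containsCnSquared {D : ℤ} (hD : D < 0) {K : Type*} [Field K] [CharZero K]
    (hK : IsRatAdjoinSqrt K D) {L : Type*} [Field L] [Algebra K L]
    [Algebra.IsQuadraticExtension K L] (E : WeierstrassCurve K) {n : ℕ} (hn : Odd n)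
    (hp : IsPrimePow n) (h : ContainsCnSquared E L n) : n = 3 := by
  classical
  have : CharZero L := charZero_of_injective_algebraMap (algebraMap K L).injective
  have : NeZero n := ⟨hp.ne_zero⟩
  obtain ⟨hfin, hrank⟩ := hK.finrank_le
  have : FiniteDimensional K L := inferInstance
  have : FiniteDimensional ℚ L := FiniteDimensional.trans ℚ K L
  have hL : finrank ℚ L ≤ 4 := by
    rw [← finrank_mul_finrank ℚ K L, Algebra.IsQuadraticExtension.finrank_eq_two K L]
    omega
  obtain ⟨f, hf⟩ := h
  obtain ⟨ζ, hζ⟩ :=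
    WeierstrassCurve.Affine.Point.exists_isPrimitiveRoot hn (Nat.cast_ne_zero.mpr hp.ne_zero) hf
  refine (eq_three_or_five_of_totient_le hn hp (hζ.totient_le_finrank.trans hL)).resolve_right ?_
  rintro rfl
  obtain ⟨s, hs, -⟩ := hK
  exact hζ.sq_ne_neg_of_finrank_le_four hL hD (s := algebraMap K L s)
    (by rw [← map_pow, hs, map_intCast])

/-- A field without a square root of `a` has a quadratic extension with such a square root. -/
lemma exists_quadratic_extension {K : Type u} [Field K] {a : K} (ha : ∀ b : K, b ^ 2 ≠ a) :
    ∃ (L : Type u) (_ : Field L) (_ : Algebra K L), Algebra.IsQuadraticExtension K L ∧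
      ∃ b : L, b ^ 2 = algebraMap K L a := by
  have hirr : Irreducible (X ^ 2 - C a : K[X]) := X_pow_sub_C_irreducible_of_prime Nat.prime_two ha
  have : Fact (Irreducible (X ^ 2 - C a : K[X])) := ⟨hirr⟩
  refine ⟨AdjoinRoot (X ^ 2 - C a), inferInstance, inferInstance, ?_, AdjoinRoot.root _, ?_⟩
  · refine { finrank_eq_two' := ?_ }
    rw [(AdjoinRoot.powerBasis hirr.ne_zero).finrank, AdjoinRoot.powerBasis_dim,
      natDegree_X_pow_sub_C]
  · have := AdjoinRoot.eval₂_root (X ^ 2 - C a : K[X])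
    rw [eval₂_sub, eval₂_X_pow, eval₂_C, sub_eq_zero] at this
    exact this

lemma containsCnSquared_three {K : Type*} [Field K] [CharZero K] {L : Type*} [Field L]
    [Algebra K L] {r : L} (hr : r ^ 2 = -3) :
    ContainsCnSquared (fullThreeTorsionCurve.baseChange K) L 3 := by
  classical
  have : CharZero L := charZero_of_injective_algebraMap (algebraMap K L).injective
  refine exists_three_torsion ?_ ?_ ?_ ?_ ?_ hr <;>
    simp [WeierstrassCurve.baseChange, fullThreeTorsionCurve]
  exact map_ofNat _ 9

theorem mainTheorem5 (D : ℤ) (hD : D = -1 ∨ D = -3)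
    (K : Type u) [Field K] [CharZero K] (hK : IsRatAdjoinSqrt K D) :
    (∀ (L : Type v) [Field L] [Algebra K L] [Algebra.IsQuadraticExtension K L]
        (E : WeierstrassCurve K) [E.IsElliptic] (n : ℕ),
        Odd n → IsPrimePow n → ContainsCnSquared E L n → n = 3) ∧
    (fullThreeTorsionCurve.baseChange K).IsElliptic ∧
    (∃ (L : Type u) (_ : Field L) (_ : Algebra K L),
        Algebra.IsQuadraticExtension K L ∧
        (∃ i : L, i ^ 2 = -1) ∧ (∃ r : L, r ^ 2 = -3) ∧
        ContainsCnSquared (fullThreeTorsionCurve.baseChange K) L 3) := by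
  have hneg : D < 0 := by omega
  refine ⟨fun L _ _ _ E _ n hn hp h => eq_three_of_containsCnSquared hneg hK E hn hp h,
    inferInstanceAs (fullThreeTorsionCurve.map _).IsElliptic, ?_⟩
  -- The integer division is exact: `3 / D` is the other of `-1` and `-3`, whose square root is
  -- adjoined to form `L`.
  have hsq : ¬ IsSquare (D * (3 / D)) := by
    have : ¬ IsSquare (3 : ℤ) := by norm_num
    rcases hD with rfl | rfl <;> exact this
  obtain ⟨L, _, _, hL, t, ht⟩ := exists_quadratic_extension
    (hK.not_isSquare_int (D' := 3 / D) hneg (by rcases hD with rfl | rfl <;> decide) hsq)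
  obtain ⟨s, hs, -⟩ := hK
  have hs' : algebraMap K L s ^ 2 = (D : L) := by rw [← map_pow, hs, map_intCast]
  rw [map_intCast] at ht
  refine ⟨L, _, _, hL, ?_⟩
  rcases hD with rfl | rfl
  · have hr : t ^ 2 = -3 := by rw [ht]; norm_num
    exact ⟨⟨_, by simpa using hs'⟩, ⟨t, hr⟩, containsCnSquared_three hr⟩
  · have hr : algebraMap K L s ^ 2 = -3 := by rw [hs']; norm_num
    exact ⟨⟨t, by rw [ht]; norm_num⟩, ⟨_, hr⟩, containsCnSquared_three hr⟩
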